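/- Let $\mu$ be a positive Borel measure on $\mathbb{R}$ all of whose moments exist and whose support is infinite, and let $\{p_j\}_{j\ge 0}$ be polynomials with real coefficients, $\deg p_j=j$, orthonormal with respect to $\mu$: $\int p_jp_k\,d\mu=\delta_{jk}$. Let $k_j$ be the leading coefficient of $p_j$. Let $N>0$ be an integer, let $a_0,\dots,a_N,b_0,\dots,b_N$ be mutually independent real Gaussian random variables with mean $0$ and variance $1$, put $\eta_j=a_j+ib_j$ and $S_N(z)=\sum_{j=0}^N\eta_jp_j(z)$, and let $\mathbf{K}=(K_1,K_2)\in\mathbb{R}^2$. For compact $\Phi\subset\mathbb{C}$ let $\nu_{N,\mathbf{K}}(\Phi)$ be the number of points $z\in\Phi$ with $S_N(z)=K_1+iK_2$. Then there is a continuous function $h_{N,\mathbf{K}}:\mathbb{C}\to\mathbb{R}$ such that $$\mathbb{E}\,\nu_{N,\mathbf{K}}(\Phi)=\int_\Phi h_{N,\mathbf{K}}(z)\,dz<\infty\qquad\text{for every compact }\Phi\subset\mathbb{C}$$ (with $dz$ the Lebesgue measure of the plane); every other locally integrable function with this property equals it almost everywhere; and for every $z$ with $\operatorname{Im}z\ne0$,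 writing $$I=\operatorname{Im}\bigl(p_{N+1}(z)\overline{p_N(z)}\bigr),\quad J=\operatorname{Im}\bigl(p_{N+1}'(z)\overline{p_N'(z)}\bigr),\quad D=\overline{p_N(z)}\,p_{N+1}'(z)-\overline{p_{N+1}(z)}\,p_N'(z),$$ one has $I\neq 0$ and $$h_{N,\mathbf{K}}(z)=\frac1\pi\exp\Bigl(-\frac{(K_1^2+K_2^2)\,k_{N+1}\operatorname{Im}z}{2k_N\,I}\Bigr)\Bigl\{\frac JI-\frac{|D|^2}{4I^2}+\frac1{4(\operatorname{Im}z)^2}+\frac{(K_1^2+K_2^2)k_{N+1}}{k_N}\Bigl(\frac{|D|^2\operatorname{Im}z}{8I^3}-\frac{\operatorname{Re}D}{4I^2}+\frac1{8\,I\operatorname{Im}z}\Bigr)\Bigr\}.$$ When $\mathbf{K}=\mathbf{0}$, for every $z$ with $\operatorname{Im}z\neq0$, $$h_{N,\mathbf{0}}(z)=\frac1\pi\Bigl(\frac JI-\frac{|D|^2}{4I^2}+\frac1{4(\operatorname{Im}z)^2}\Bigr).$$ -/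

import Mathlib

open MeasureTheory ProbabilityTheory Polynomial

/-- `p 0, p 1, p 2, …` are the orthonormal polynomials (with real coefficients) on the real line
with respect to the distribution `dα = μ`: all moments of `μ` exist, `μ` has infinitely many
points of increase, `p n` has degree exactly `n`, and `∫ p_j p_k dμ = δ_{jk}`. -/
structure IsOrthonormalPolynomials (μ : Measure ℝ) (p : ℕ → ℝ[X]) : Prop where
  integrable_pow : ∀ n : ℕ, Integrable (fun x : ℝ => x ^ n) μ
  infinite_support : μ.support.Infinite
  degree_eq : ∀ n : ℕ, (p n).degree = n
  integral_mul : ∀ j k : ℕ,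
    ∫ x, (p j).eval x * (p k).eval x ∂μ = if j = k then 1 else 0

/-- `a 0, …, a N, b 0, …, b N` are mutually independent real random variables, each of them
normally distributed with mean zero and variance one. -/
structure IsIIDStandardGaussian {Ω : Type*} [MeasurableSpace Ω] (P : Measure Ω) (N : ℕ)
    (a b : Fin (N + 1) → Ω → ℝ) : Prop where
  measurable_left : ∀ j, Measurable (a j)
  measurable_right : ∀ j, Measurable (b j)
  law_left : ∀ j, P.map (a j) = gaussianReal 0 1
  law_right : ∀ j, P.map (b j) = gaussianReal 0 1
  indep : iIndepFun (Sum.elim a b) P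

/-- The random sum `S_N(z) = ∑_{j=0}^N η_j f_j(z)`, where `η_j = a_j + i b_j`. -/
noncomputable def randomSum {Ω : Type*} {N : ℕ} (a b : Fin (N + 1) → Ω → ℝ)
    (f : ℕ → ℂ → ℂ) (ω : Ω) (z : ℂ) : ℂ :=
  ∑ j : Fin (N + 1), ((a j ω : ℂ) + (b j ω : ℂ) * Complex.I) * f j z

/-- The number (possibly infinite) of points `z ∈ Φ` with `F z = K`. -/
noncomputable def levelCount (F : ℂ → ℂ) (K : ℂ) (Φ : Set ℂ) : ENNReal :=
  (({z | z ∈ Φ ∧ F z = K}.encard : ℕ∞) : ENNReal)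

/-- `h` is a density of the expected number of solutions of the random equation `S(z) = K`:
for every compact `Φ`, the expected number of solutions in `Φ` is finite and equals
`∫_Φ h(z) dz`, the integral being with respect to the Lebesgue measure of the plane. -/
def IsExpectedZeroDensity {Ω : Type*} [MeasurableSpace Ω] (P : Measure Ω)
    (S : Ω → ℂ → ℂ) (K : ℂ) (h : ℂ → ℝ) : Prop :=
  ∀ Φ : Set ℂ, IsCompact Φ →
    AEMeasurable (fun ω => levelCount (S ω) K Φ) P ∧
    IntegrableOn h Φ volume ∧
    ∫⁻ ω, levelCount (S ω) K Φ ∂P ≠ ⊤ ∧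
    (∫⁻ ω, levelCount (S ω) K Φ ∂P).toReal = ∫ z in Φ, h z

/-- The value `q(z)` of a real polynomial at a complex point. -/
noncomputable def valC (q : ℝ[X]) (z : ℂ) : ℂ := aeval z q

/-- `Im (p_{N+1}(z) * conj p_N(z))`. -/
noncomputable def cdIm (p : ℕ → ℝ[X]) (N : ℕ) (z : ℂ) : ℝ :=
  (valC (p (N + 1)) z * (starRingEnd ℂ) (valC (p N) z)).im

/-- `Im (p_{N+1}'(z) * conj p_N'(z))`. -/
noncomputable def cdDerivIm (p : ℕ → ℝ[X]) (N : ℕ) (z : ℂ) : ℝ :=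
  (valC (derivative (p (N + 1))) z * (starRingEnd ℂ) (valC (derivative (p N)) z)).im

/-- `conj p_N(z) * p_{N+1}'(z) - conj p_{N+1}(z) * p_N'(z)`. -/
noncomputable def cdMixed (p : ℕ → ℝ[X]) (N : ℕ) (z : ℂ) : ℂ :=
  (starRingEnd ℂ) (valC (p N) z) * valC (derivative (p (N + 1))) z
    - (starRingEnd ℂ) (valC (p (N + 1)) z) * valC (derivative (p N)) z

/-- The ratio `k_{N+1} / k_N` of highest coefficients. -/
noncomputable def coeffRatio (p : ℕ → ℝ[X]) (N : ℕ) : ℝ :=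
  (p (N + 1)).leadingCoeff / (p N).leadingCoeff

/-! Since `p 0` is a nonzero constant `c`, fixing `η_1, …, η_N` turns `S_N(z) = K` into `η_0 = (K -
G(z)) / c`, with `G` the polynomial formed by the remaining terms. The area formula for this map,
weighted by the Gaussian density of `η_0`, writes the conditional expected count as an integral over
`Φ` of `|G'|²` times the density of `c η_0` at `K - G` (`lintegral_levelCount_const_mul_add`).

By Tonelli the other coefficients can be averaged at each fixed `z`. The integrand belongs to the
family `gaussianLevelDensity v t s`, which is stable under averaging over one more coefficient: `v`,
`t`, `s` increase by `|w|²`, `β w̄`, `|β|²` (`lintegral_gaussianLevelDensity_step`). Hence the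
density depends only on the sums of `|p_j|²`, `p_j' p̄_j`, `|p_j'|²`; it is continuous on all of
`ℂ`, because the first sum never vanishes.

Off the real axis, the Christoffel–Darboux identity and its derivatives at `(z, z̄)` express these
sums through `p_N` and `p_{N+1}`, which gives the closed formula. Uniqueness holds because integrals
over compact sets determine a locally integrable function almost everywhere. -/

/-! ### Gaussian integrals over the plane. -/

/-- The law of `a + i b` for independent standard real Gaussian variables `a` and `b`. -/
noncomputable def complexGaussian : Measure ℂ :=
  volume.withDensity fun z => ENNReal.ofReal ((2 * Real.pi)⁻¹ * Real.exp (-(‖z‖ ^ 2 / 2)))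

lemma map_gaussianReal_prod_eq_complexGaussian :
    ((gaussianReal 0 1).prod (gaussianReal 0 1)).map
      (fun x : ℝ × ℝ => (x.1 : ℂ) + (x.2 : ℂ) * Complex.I) = complexGaussian := by
  have hf : (fun x : ℝ × ℝ => (x.1 : ℂ) + (x.2 : ℂ) * Complex.I)
      = Complex.measurableEquivRealProd.symm := by
    funext x
    apply Complex.ext <;> simp [Complex.measurableEquivRealProd]
  rw [hf, gaussianReal_of_var_ne_zero 0 one_ne_zero,
    prod_withDensity (measurable_gaussianPDF 0 1) (measurable_gaussianPDF 0 1)]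
  have hvp := Complex.volume_preserving_equiv_real_prod.symm
  rw [← Measure.volume_eq_prod]
  ext s hs
  rw [Measure.map_apply (MeasurableEquiv.measurable _) hs, complexGaussian,
    withDensity_apply _ hs, withDensity_apply _ (MeasurableEquiv.measurable _ hs),
    ← hvp.setLIntegral_comp_preimage_emb (MeasurableEquiv.measurableEmbedding _)]
  refine setLIntegral_congr_fun (MeasurableEquiv.measurable _ hs) fun x _ => ?_
  simp only [gaussianPDF]
  rw [← ENNReal.ofReal_mul (gaussianPDFReal_nonneg 0 1 _), ← hf]
  congr 1
  simp only [gaussianPDFReal, sub_zero, NNReal.coe_one, mul_one]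
  have h2 : ‖(x.1 : ℂ) + (x.2 : ℂ) * Complex.I‖ ^ 2 = x.1 ^ 2 + x.2 ^ 2 := by
    rw [← Complex.normSq_eq_norm_sq, Complex.normSq_add_mul_I]
  rw [h2, mul_mul_mul_comm, ← Real.exp_add, ← mul_inv, Real.mul_self_sqrt (by positivity)]
  congr 2
  ring

instance : IsProbabilityMeasure complexGaussian := by
  rw [← map_gaussianReal_prod_eq_complexGaussian]
  exact Measure.isProbabilityMeasure_map (by fun_prop)

lemma integral_exp_neg_mul_sq_norm {s : ℝ} (hs : 0 < s) :
    ∫ z : ℂ, Real.exp (-(s * ‖z‖ ^ 2 / 2)) = 2 * Real.pi / s := by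
  have h := Complex.integral_rpow_mul_exp_neg_mul_rpow (p := 2) (q := 0) (b := s / 2)
    (by norm_num) (by norm_num) (by positivity)
  have e : ∀ z : ℂ, ‖z‖ ^ (0 : ℝ) * Real.exp (-(s / 2) * ‖z‖ ^ (2 : ℝ))
      = Real.exp (-(s * ‖z‖ ^ 2 / 2)) := fun z => by
    rw [Real.rpow_zero, one_mul, Real.rpow_two]; congr 1; ring
  simp_rw [e] at h
  rw [h]
  norm_num [Real.rpow_neg_one]
  field_simp

lemma integral_sq_norm_mul_exp_neg_mul_sq_norm {s : ℝ} (hs : 0 < s) :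
    ∫ z : ℂ, ‖z‖ ^ 2 * Real.exp (-(s * ‖z‖ ^ 2 / 2)) = 4 * Real.pi / s ^ 2 := by
  have h := Complex.integral_rpow_mul_exp_neg_mul_rpow (p := 2) (q := 2) (b := s / 2)
    (by norm_num) (by norm_num) (by positivity)
  have e : ∀ z : ℂ, ‖z‖ ^ (2 : ℝ) * Real.exp (-(s / 2) * ‖z‖ ^ (2 : ℝ))
      = ‖z‖ ^ 2 * Real.exp (-(s * ‖z‖ ^ 2 / 2)) := fun z => by
    rw [Real.rpow_two]; congr 2; ring
  simp_rw [e] at h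
  rw [h]
  have h2 : (s / 2) ^ (-(2 + 2) / 2 : ℝ) = ((s / 2) ^ 2)⁻¹ := by
    rw [show (-(2 + 2) / 2 : ℝ) = -(2 : ℕ) by norm_num, Real.rpow_neg (by positivity),
      Real.rpow_natCast]
  rw [h2]
  norm_num
  field_simp
  norm_num

/-- The weight is even, so averaging over `z` and `-z` removes the cross term by the parallelogram
law; only the zeroth and second moments remain. -/
lemma lintegral_sq_norm_affine_mul_exp {s : ℝ} (hs : 0 < s) (a b : ℂ) {σ : ℝ} (hσ : 0 ≤ σ) :
    ∫⁻ z : ℂ, ENNReal.ofReal ((‖a + b * z‖ ^ 2 + σ) * Real.exp (-(s * ‖z‖ ^ 2 / 2)))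
      = ENNReal.ofReal (2 * Real.pi / s * (‖a‖ ^ 2 + 2 * ‖b‖ ^ 2 / s + σ)) := by
  have hπ := Real.pi_pos
  set f : ℂ → ENNReal :=
    fun z => ENNReal.ofReal ((‖a + b * z‖ ^ 2 + σ) * Real.exp (-(s * ‖z‖ ^ 2 / 2))) with hf
  have hneg : ∫⁻ z, f (-z) = ∫⁻ z, f z := lintegral_neg_eq_self f
  have hsum : ∀ z, f z + f (-z) = ENNReal.ofReal
      (2 * ((‖a‖ ^ 2 + σ) * Real.exp (-(s * ‖z‖ ^ 2 / 2))
        + ‖b‖ ^ 2 * (‖z‖ ^ 2 * Real.exp (-(s * ‖z‖ ^ 2 / 2))))) := fun z => by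
    simp only [hf, norm_neg]
    rw [← ENNReal.ofReal_add (by positivity) (by positivity)]
    congr 1
    have h := parallelogram_law_with_norm ℝ a (b * z)
    simp only [norm_mul, ← sub_eq_add_neg, mul_neg] at h ⊢
    linear_combination Real.exp (-(s * ‖z‖ ^ 2 / 2)) * h
  have i0 : Integrable fun z : ℂ => Real.exp (-(s * ‖z‖ ^ 2 / 2)) :=
    .of_integral_ne_zero (by rw [integral_exp_neg_mul_sq_norm hs]; positivity)
  have i2 : Integrable fun z : ℂ => ‖z‖ ^ 2 * Real.exp (-(s * ‖z‖ ^ 2 / 2)) :=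
    .of_integral_ne_zero (by rw [integral_sq_norm_mul_exp_neg_mul_sq_norm hs]; positivity)
  have h2 : 2 * ∫⁻ z, f z
      = 2 * ENNReal.ofReal (2 * Real.pi / s * (‖a‖ ^ 2 + 2 * ‖b‖ ^ 2 / s + σ)) := by
    rw [two_mul]
    nth_rewrite 2 [← hneg]
    rw [← lintegral_add_left (by fun_prop)]
    simp_rw [hsum]
    have hI : Integrable fun z : ℂ => 2 * ((‖a‖ ^ 2 + σ) * Real.exp (-(s * ‖z‖ ^ 2 / 2))
        + ‖b‖ ^ 2 * (‖z‖ ^ 2 * Real.exp (-(s * ‖z‖ ^ 2 / 2)))) :=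
      ((i0.const_mul _).add (i2.const_mul _)).const_mul _
    rw [← ofReal_integral_eq_lintegral_ofReal hI (.of_forall fun z => by positivity),
      integral_const_mul, integral_add (i0.const_mul _) (i2.const_mul _), integral_const_mul,
      integral_const_mul, integral_exp_neg_mul_sq_norm hs,
      integral_sq_norm_mul_exp_neg_mul_sq_norm hs, ENNReal.ofReal_mul (by norm_num)]
    congr 1
    · simp
    · congr 1
      field_simp
      ring
  exact (ENNReal.mul_right_inj two_ne_zero ENNReal.ofNat_ne_top).1 h2

/-! ### Averaging the conditional density over independent coefficients. -/

/-- If `(X, Y)` is a centred circular complex Gaussian pair with `E |X|² = 2 v`, `E Y X̄ = 2 t`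
and `E |Y|² = 2 s`, this is the density of `X` at `K` times `E (|A + Y|² | X = K)`. -/
noncomputable def gaussianLevelDensity (v : ℝ) (t : ℂ) (s : ℝ) (A K : ℂ) : ℝ :=
  (‖A + t * K / v‖ ^ 2 + 2 * (s - ‖t‖ ^ 2 / v))
    * ((2 * Real.pi * v)⁻¹ * Real.exp (-(‖K‖ ^ 2 / (2 * v))))

lemma gaussianLevelDensity_nonneg {v : ℝ} (hv : 0 < v) {t : ℂ} {s : ℝ} (h : ‖t‖ ^ 2 ≤ s * v)
    (A K : ℂ) : 0 ≤ gaussianLevelDensity v t s A K := by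
  have hπ := Real.pi_pos
  have : 0 ≤ s - ‖t‖ ^ 2 / v := by rw [sub_nonneg, div_le_iff₀ hv]; exact h
  unfold gaussianLevelDensity
  positivity

lemma continuous_gaussianLevelDensity (v : ℝ) (t : ℂ) (s : ℝ) :
    Continuous fun x : ℂ × ℂ => gaussianLevelDensity v t s x.1 x.2 := by
  unfold gaussianLevelDensity
  simp only [div_eq_mul_inv]
  fun_prop

/-- Replacing `(X, Y)` by `(X + wξ, Y + βξ)`, with `ξ` independent, changes the covariances exactly
as on the right. The computation is a completion of the square in `ξ`. -/
lemma lintegral_gaussianLevelDensity_step {v : ℝ} (hv : 0 < v) {t : ℂ} {s : ℝ}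
    (h : ‖t‖ ^ 2 ≤ s * v) (A K β w : ℂ) :
    ∫⁻ ξ, ENNReal.ofReal (gaussianLevelDensity v t s (A + β * ξ) (K - w * ξ)) ∂complexGaussian
      = ENNReal.ofReal (gaussianLevelDensity (v + ‖w‖ ^ 2) (t + β * (starRingEnd ℂ) w)
          (s + ‖β‖ ^ 2) A K) := by
  have hπ := Real.pi_pos
  have hσ : 0 ≤ s - ‖t‖ ^ 2 / v := by rw [sub_nonneg, div_le_iff₀ hv]; exact h
  have hv' : 0 < v + ‖w‖ ^ 2 := by positivity
  have hvC : (v : ℂ) ≠ 0 := by exact_mod_cast hv.ne'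
  have hwC : (v : ℂ) + w * (starRingEnd ℂ) w ≠ 0 := by
    rw [Complex.mul_conj, Complex.normSq_eq_norm_sq]; exact_mod_cast hv'.ne'
  -- With `K = (v + |w|²) κ`, the mean of `ξ` given `X + wξ = K` is `w̄ κ`. Translating by it
  -- removes the linear term from the exponent.
  obtain ⟨κ, rfl⟩ : ∃ κ : ℂ, K = (v + w * (starRingEnd ℂ) w) * κ :=
    ⟨K / (v + w * (starRingEnd ℂ) w), by field_simp⟩
  have hcast : ((v + ‖w‖ ^ 2 : ℝ) : ℂ) = v + w * (starRingEnd ℂ) w := by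
    rw [Complex.mul_conj, Complex.normSq_eq_norm_sq]; push_cast; rfl
  have hcont : Continuous fun ξ : ℂ =>
      gaussianLevelDensity v t s (A + β * ξ) ((v + w * (starRingEnd ℂ) w) * κ - w * ξ) :=
    (continuous_gaussianLevelDensity v t s).comp (by fun_prop : Continuous fun ξ : ℂ =>
      (A + β * ξ, (v + w * (starRingEnd ℂ) w) * κ - w * ξ))
  rw [complexGaussian, lintegral_withDensity_eq_lintegral_mul _ (by fun_prop)
    hcont.measurable.ennreal_ofReal,
    ← lintegral_add_right_eq_self _ ((starRingEnd ℂ) w * κ)]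
  have key : ∀ ζ : ℂ, ((fun z : ℂ => ENNReal.ofReal
        ((2 * Real.pi)⁻¹ * Real.exp (-(‖z‖ ^ 2 / 2)))) * fun ξ => ENNReal.ofReal
          (gaussianLevelDensity v t s (A + β * ξ) ((v + w * (starRingEnd ℂ) w) * κ - w * ξ)))
        (ζ + (starRingEnd ℂ) w * κ)
      = ENNReal.ofReal ((2 * Real.pi)⁻¹ * ((2 * Real.pi * v)⁻¹
          * Real.exp (-((v + ‖w‖ ^ 2) * ‖κ‖ ^ 2 / 2)))) * ENNReal.ofReal
          ((‖(A + (t + β * (starRingEnd ℂ) w) * κ) + (β - t * w / v) * ζ‖ ^ 2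
            + 2 * (s - ‖t‖ ^ 2 / v)) * Real.exp (-((v + ‖w‖ ^ 2) / v * ‖ζ‖ ^ 2 / 2))) := by
    intro ζ
    simp only [Pi.mul_apply, gaussianLevelDensity]
    rw [← ENNReal.ofReal_mul (by positivity), ← ENNReal.ofReal_mul (by positivity)]
    have e1 : A + β * (ζ + (starRingEnd ℂ) w * κ)
          + t * ((v + w * (starRingEnd ℂ) w) * κ - w * (ζ + (starRingEnd ℂ) w * κ)) / v
        = (A + (t + β * (starRingEnd ℂ) w) * κ) + (β - t * w / v) * ζ := by
      field_simp; ring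
    have e2 : Real.exp (-(‖ζ + (starRingEnd ℂ) w * κ‖ ^ 2 / 2))
          * Real.exp (-(‖(v + w * (starRingEnd ℂ) w) * κ
              - w * (ζ + (starRingEnd ℂ) w * κ)‖ ^ 2 / (2 * v)))
        = Real.exp (-((v + ‖w‖ ^ 2) * ‖κ‖ ^ 2 / 2))
          * Real.exp (-((v + ‖w‖ ^ 2) / v * ‖ζ‖ ^ 2 / 2)) := by
      rw [← Real.exp_add, ← Real.exp_add]
      congr 1
      simp only [← Complex.normSq_eq_norm_sq, Complex.normSq_apply, Complex.add_re,
        Complex.add_im, Complex.sub_re, Complex.sub_im, Complex.mul_re, Complex.mul_im,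
        Complex.conj_re, Complex.conj_im, Complex.ofReal_re, Complex.ofReal_im]
      field_simp
      ring
    rw [e1]
    congr 1
    linear_combination (2 * Real.pi)⁻¹ * (2 * Real.pi * v)⁻¹ *
      (‖(A + (t + β * (starRingEnd ℂ) w) * κ) + (β - t * w / v) * ζ‖ ^ 2
            + 2 * (s - ‖t‖ ^ 2 / v)) * e2
  simp_rw [key]
  rw [lintegral_const_mul _ (by fun_prop),
    lintegral_sq_norm_affine_mul_exp (by positivity) _ _ (by positivity),
    ← ENNReal.ofReal_mul (by positivity), gaussianLevelDensity, hcast]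
  congr 1
  have e3 : (t + β * (starRingEnd ℂ) w) * ((v + w * (starRingEnd ℂ) w) * κ)
      / (v + w * (starRingEnd ℂ) w) = (t + β * (starRingEnd ℂ) w) * κ := by
    rw [mul_div_assoc, mul_div_cancel_left₀ _ hwC]
  have e4 : ‖(v + w * (starRingEnd ℂ) w) * κ‖ ^ 2 / (2 * (v + ‖w‖ ^ 2))
      = (v + ‖w‖ ^ 2) * ‖κ‖ ^ 2 / 2 := by
    rw [← hcast, norm_mul, Complex.norm_real, mul_pow, Real.norm_eq_abs, sq_abs]
    field_simp
  -- The conditional variances match: what `ζ` contributes plus the old residual is the new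
  -- residual.
  have e5 : 2 * ‖β - t * w / v‖ ^ 2 / ((v + ‖w‖ ^ 2) / v) + 2 * (s - ‖t‖ ^ 2 / v)
      = 2 * (s + ‖β‖ ^ 2 - ‖t + β * (starRingEnd ℂ) w‖ ^ 2 / (v + ‖w‖ ^ 2)) := by
    have hb : ‖β - t * w / v‖ ^ 2 = ‖v * β - t * w‖ ^ 2 / v ^ 2 := by
      rw [show β - t * w / v = (v * β - t * w) / v by field_simp, norm_div, div_pow,
        Complex.norm_real, Real.norm_eq_abs, sq_abs]
    rw [hb]
    field_simp
    simp only [← Complex.normSq_eq_norm_sq, Complex.normSq_apply, Complex.add_re,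
        Complex.add_im, Complex.sub_re, Complex.sub_im, Complex.mul_re, Complex.mul_im,
        Complex.conj_re, Complex.conj_im, Complex.ofReal_re, Complex.ofReal_im]
    ring
  rw [e3, e4, ← e5]
  generalize ‖β - t * w / (v : ℂ)‖ = B
  field_simp
  ring

/-- The covariance matrix stays positive semidefinite when a rank-one term is added; this carries
the Cauchy–Schwarz hypothesis through the inductions. -/
lemma norm_sq_add_mul_conj_le {v : ℝ} (hv : 0 < v) {t : ℂ} {s : ℝ} (h : ‖t‖ ^ 2 ≤ s * v)
    (β w : ℂ) : ‖t + β * (starRingEnd ℂ) w‖ ^ 2 ≤ (s + ‖β‖ ^ 2) * (v + ‖w‖ ^ 2) := by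
  have h0 : ‖t + β * (starRingEnd ℂ) w‖ ≤ ‖t‖ + ‖β‖ * ‖w‖ := by
    simpa using norm_add_le t (β * (starRingEnd ℂ) w)
  have h1 : 2 * ‖t‖ * (‖β‖ * ‖w‖) ≤ s * ‖w‖ ^ 2 + ‖β‖ ^ 2 * v := by
    have h2 : ‖t‖ ^ 2 / v ≤ s := by rwa [div_le_iff₀ hv]
    have h3 : 0 ≤ (‖t‖ * ‖w‖ - ‖β‖ * v) ^ 2 / v := by positivity
    have h4 : (‖t‖ * ‖w‖ - ‖β‖ * v) ^ 2 / v
        = ‖t‖ ^ 2 / v * ‖w‖ ^ 2 - 2 * ‖t‖ * (‖β‖ * ‖w‖) + ‖β‖ ^ 2 * v := by field_simp; ring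
    nlinarith [mul_le_mul_of_nonneg_right h2 (sq_nonneg ‖w‖)]
  nlinarith [norm_nonneg (t + β * (starRingEnd ℂ) w)]

lemma lintegral_pi_gaussianLevelDensity {n : ℕ} (β w : Fin n → ℂ) {v : ℝ} (hv : 0 < v) {t : ℂ}
    {s : ℝ} (h : ‖t‖ ^ 2 ≤ s * v) (A K : ℂ) :
    ∫⁻ ξ : Fin n → ℂ, ENNReal.ofReal
        (gaussianLevelDensity v t s (A + ∑ j, β j * ξ j) (K - ∑ j, w j * ξ j))
        ∂(Measure.pi fun _ => complexGaussian)
      = ENNReal.ofReal (gaussianLevelDensity (v + ∑ j, ‖w j‖ ^ 2)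
          (t + ∑ j, β j * (starRingEnd ℂ) (w j)) (s + ∑ j, ‖β j‖ ^ 2) A K) := by
  induction n generalizing v t s with
  | zero => simp
  | succ n ih =>
    have hmp := (measurePreserving_piFinSuccAbove (fun _ : Fin (n + 1) => complexGaussian) 0).symm
    have hcont : Continuous fun x : ℂ × (Fin n → ℂ) => gaussianLevelDensity v t s
        (A + (β 0 * x.1 + ∑ j : Fin n, β j.succ * x.2 j))
        (K - (w 0 * x.1 + ∑ j : Fin n, w j.succ * x.2 j)) :=
      (continuous_gaussianLevelDensity v t s).comp (by fun_prop :
        Continuous fun x : ℂ × (Fin n → ℂ) =>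
          (A + (β 0 * x.1 + ∑ j : Fin n, β j.succ * x.2 j),
            K - (w 0 * x.1 + ∑ j : Fin n, w j.succ * x.2 j)))
    rw [← hmp.lintegral_comp_emb (MeasurableEquiv.measurableEmbedding _)]
    simp only [MeasurableEquiv.piFinSuccAbove_symm_apply, Fin.insertNthEquiv_apply,
      Fin.insertNth_zero', Fin.sum_univ_succ, Fin.cons_zero, Fin.cons_succ]
    rw [lintegral_prod_symm _ hcont.measurable.ennreal_ofReal.aemeasurable]
    simp only []
    have hstep : ∀ y : Fin n → ℂ, ∫⁻ ξ, ENNReal.ofReal (gaussianLevelDensity v t s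
          (A + (β 0 * ξ + ∑ j : Fin n, β j.succ * y j))
          (K - (w 0 * ξ + ∑ j : Fin n, w j.succ * y j))) ∂complexGaussian
        = ENNReal.ofReal (gaussianLevelDensity (v + ‖w 0‖ ^ 2)
          (t + β 0 * (starRingEnd ℂ) (w 0)) (s + ‖β 0‖ ^ 2)
          (A + ∑ j : Fin n, β j.succ * y j) (K - ∑ j : Fin n, w j.succ * y j)) := fun y => by
      rw [← lintegral_gaussianLevelDensity_step hv h]
      refine lintegral_congr fun ξ => ?_
      congr 2 <;> ring
    have := ih (fun j => β j.succ) (fun j => w j.succ) (v := v + ‖w 0‖ ^ 2)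
      (t := t + β 0 * (starRingEnd ℂ) (w 0)) (s := s + ‖β 0‖ ^ 2) (by positivity)
      (norm_sq_add_mul_conj_le hv h _ _)
    simp only [add_assoc] at this
    rw [← this]
    exact lintegral_congr fun y => by simpa only [add_assoc] using hstep y

/-! ### The area formula for entire functions. -/

/-- The inverse function theorem gives injectivity near each noncritical point; a countable
subcover, made disjoint, gives the pieces. -/
lemma exists_injOn_partition {f : ℂ → ℂ} (hf : Differentiable ℂ f) :
    ∃ T : ℕ → Set ℂ, (∀ n, MeasurableSet (T n)) ∧ Pairwise (Function.onFun Disjoint T) ∧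
      ⋃ n, T n = {z | deriv f z ≠ 0} ∧ ∀ n, Set.InjOn f (T n) := by
  have hopen : IsOpen {z | deriv f z ≠ 0} :=
    isOpen_ne_fun (hf.contDiff.continuous_deriv (n := 1) le_rfl) continuous_const
  have hloc : ∀ z, ∃ U : Set ℂ, IsOpen U ∧ (deriv f z ≠ 0 → z ∈ U ∧ Set.InjOn f U) := fun z => by
    by_cases hz : deriv f z = 0
    · exact ⟨∅, isOpen_empty, fun h => absurd hz h⟩
    · have hs := ((hf.analyticAt z).hasStrictDerivAt.hasStrictFDerivAt_equiv
        hz).eventually_left_inverse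
      obtain ⟨U, hU, hUo, hzU⟩ := eventually_nhds_iff.1 hs
      exact ⟨U, hUo, fun _ => ⟨hzU, fun x hx y hy hxy => by rw [← hU x hx, ← hU y hy, hxy]⟩⟩
  choose U hUo hU using hloc
  obtain ⟨t, hts, htc, hcov⟩ := TopologicalSpace.countable_cover_nhdsWithin
    (s := {z | deriv f z ≠ 0}) (f := U)
    fun z hz => mem_nhdsWithin_of_mem_nhds ((hUo z).mem_nhds (hU z hz).1)
  rcases t.eq_empty_or_nonempty with rfl | hne
  · refine ⟨fun _ => ∅, by simp, fun _ _ _ => by simp [Function.onFun], ?_, by simp⟩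
    simp only [Set.mem_empty_iff_false, Set.iUnion_false, Set.iUnion_empty] at hcov ⊢
    exact (Set.subset_empty_iff.1 hcov).symm
  · obtain ⟨g, rfl⟩ := htc.exists_eq_range hne
    refine ⟨disjointed fun n => U (g n) ∩ {z | deriv f z ≠ 0},
      fun n => MeasurableSet.disjointed (fun i => ((hUo _).inter hopen).measurableSet) n,
      disjoint_disjointed _, ?_, fun n => ?_⟩
    · rw [iUnion_disjointed, ← Set.iUnion_inter, Set.inter_eq_right]
      simpa using hcov
    · exact ((hU (g n) (hts ⟨n, rfl⟩)).2.mono Set.inter_subset_left).mono (disjointed_subset _ _)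

/-- Each injective piece meets the fibre in at most one point, so the count is a sum of indicators
of images. -/
lemma levelCount_eq_tsum {f : ℂ → ℂ} (hf : Continuous f) {Φ : Set ℂ} (hΦ : MeasurableSet Φ)
    {T : ℕ → Set ℂ} (hTm : ∀ n, MeasurableSet (T n)) (hTd : Pairwise (Function.onFun Disjoint T))
    (hTi : ∀ n, Set.InjOn f (T n)) {w : ℂ} (hw : ∀ z, f z = w → z ∈ ⋃ n, T n) :
    levelCount f w Φ = ∑' n, (f '' (Φ ∩ T n)).indicator 1 w := by
  have hfib : MeasurableSet {z | f z = w} := (isClosed_singleton.preimage hf).measurableSet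
  have hset : {z | z ∈ Φ ∧ f z = w} = ⋃ n, (Φ ∩ T n) ∩ {z | f z = w} := by
    ext z
    simp only [Set.mem_ofPred_eq, Set.mem_iUnion, Set.mem_inter_iff]
    refine ⟨fun ⟨h1, h2⟩ => ?_, fun ⟨n, ⟨h1, _⟩, h2⟩ => ⟨h1, h2⟩⟩
    obtain ⟨n, hn⟩ := Set.mem_iUnion.1 (hw z h2)
    exact ⟨n, ⟨h1, hn⟩, h2⟩
  have hmeas : MeasurableSet {z | z ∈ Φ ∧ f z = w} := hΦ.inter hfib
  rw [levelCount, ← Measure.count_apply hmeas, hset, measure_iUnion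
    (fun i j hij => ((hTd hij).mono Set.inter_subset_right Set.inter_subset_right).mono
      Set.inter_subset_left Set.inter_subset_left)
    (fun n => (hΦ.inter (hTm n)).inter hfib)]
  refine tsum_congr fun n => ?_
  by_cases h : w ∈ f '' (Φ ∩ T n)
  · obtain ⟨z, hz, rfl⟩ := h
    rw [Set.indicator_of_mem (Set.mem_image_of_mem f hz), Pi.one_apply]
    have : (Φ ∩ T n) ∩ {x | f x = f z} = {z} := by
      ext x
      simp only [Set.mem_inter_iff, Set.mem_ofPred_eq, Set.mem_singleton_iff]
      exact ⟨fun hx => hTi n hx.1.2 hz.2 hx.2, fun hx => by subst hx; exact ⟨hz, rfl⟩⟩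
    rw [this, Measure.count_singleton]
  · rw [Set.indicator_of_notMem h, Measure.count_eq_zero_iff]
    ext x
    simp only [Set.mem_inter_iff, Set.mem_ofPred_eq, Set.mem_empty_iff_false, iff_false]
    exact fun hx => h ⟨x, hx.1, hx.2⟩

/-- The area formula for entire functions. -/
lemma lintegral_mul_levelCount {f : ℂ → ℂ} (hf : Differentiable ℂ f) {Φ : Set ℂ}
    (hΦ : MeasurableSet Φ) {g : ℂ → ENNReal} (hg : Measurable g) :
    ∫⁻ w, g w * levelCount f w Φ
      = ∫⁻ z in Φ, ENNReal.ofReal (‖deriv f z‖ ^ 2) * g (f z) := by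
  obtain ⟨T, hTm, hTd, hTU, hTi⟩ := exists_injOn_partition hf
  set D : ℂ → ℂ →L[ℝ] ℂ := fun z =>
    (ContinuousLinearMap.toSpanSingleton ℂ (deriv f z)).restrictScalars ℝ with hD
  have hdet : ∀ z, (D z).det = ‖deriv f z‖ ^ 2 := fun z => by
    simp [hD, ContinuousLinearMap.det, LinearMap.det_restrictScalars,
      Algebra.norm_complex_apply, Complex.normSq_eq_norm_sq]
  have hder : ∀ (s : Set ℂ), ∀ z ∈ s, HasFDerivWithinAt f (D z) s z := fun s z _ =>
    ((hf z).hasDerivAt.hasFDerivAt.restrictScalars ℝ).hasFDerivWithinAt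
  -- Sard: critical values are null, so almost every fibre lies in the union of the pieces.
  have hnull : volume (f '' {z | deriv f z = 0}) = 0 :=
    addHaar_image_eq_zero_of_det_fderivWithin_eq_zero volume (hder _) fun z hz => by
      have hz0 : deriv f z = 0 := hz
      rw [hdet, hz0]; simp
  have hmeas : ∀ n, MeasurableSet (f '' (Φ ∩ T n)) := fun n =>
    (hΦ.inter (hTm n)).image_of_continuousOn_injOn hf.continuous.continuousOn
      ((hTi n).mono Set.inter_subset_right)
  have hdisj : Pairwise (Function.onFun Disjoint fun n => Φ ∩ T n) := fun i j hij =>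
    (hTd hij).mono Set.inter_subset_right Set.inter_subset_right
  calc ∫⁻ w, g w * levelCount f w Φ
      = ∫⁻ w, ∑' n, (f '' (Φ ∩ T n)).indicator g w := by
        refine lintegral_congr_ae ?_
        filter_upwards [measure_eq_zero_iff_ae_notMem.1 hnull] with w hw
        rw [levelCount_eq_tsum hf.continuous hΦ hTm hTd hTi, ← ENNReal.tsum_mul_left]
        · refine tsum_congr fun n => ?_
          by_cases h : w ∈ f '' (Φ ∩ T n) <;> simp [Set.indicator, h]
        · intro z hz
          rw [hTU]
          exact fun h0 => hw ⟨z, h0, hz⟩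
    _ = ∑' n, ∫⁻ w in f '' (Φ ∩ T n), g w := by
        rw [lintegral_tsum fun n => (hg.indicator (hmeas n)).aemeasurable]
        exact tsum_congr fun n => lintegral_indicator (hmeas n) _
    _ = ∑' n, ∫⁻ z in Φ ∩ T n, ENNReal.ofReal (‖deriv f z‖ ^ 2) * g (f z) := by
        refine tsum_congr fun n => ?_
        rw [lintegral_image_eq_lintegral_abs_det_fderiv_mul volume (hΦ.inter (hTm n))
          (hder _) ((hTi n).mono Set.inter_subset_right)]
        simp only [hdet, abs_pow, abs_norm]
    _ = ∫⁻ z in Φ ∩ {z | deriv f z ≠ 0}, ENNReal.ofReal (‖deriv f z‖ ^ 2) * g (f z) := by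
        rw [← lintegral_iUnion (fun n => hΦ.inter (hTm n)) hdisj, ← Set.inter_iUnion, hTU]
    _ = ∫⁻ z in Φ, ENNReal.ofReal (‖deriv f z‖ ^ 2) * g (f z) := by
        have hTs : MeasurableSet {z | deriv f z ≠ 0} := hTU ▸ MeasurableSet.iUnion hTm
        have h0 : ∫⁻ z in Φ \ {z | deriv f z ≠ 0},
            ENNReal.ofReal (‖deriv f z‖ ^ 2) * g (f z) = 0 := by
          refine setLIntegral_eq_zero (hΦ.diff hTs) fun z hz => ?_
          have : deriv f z = 0 := by simpa using hz.2
          simp [this]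
        rw [← lintegral_inter_add_sdiff _ Φ hTs, h0, add_zero]

/-! ### Measurability of the number of solutions. -/

/-- Distinctness is an open condition; a uniform separation `1 / (m + 1)` replaces it by a countable
union of closed ones. -/
lemma natCast_le_encard_fiber_iff {X : Type*} (F : X → ℂ → ℂ) (K : ℂ) (Φ : Set ℂ) (x : X) (k : ℕ) :
    (k : ℕ∞) ≤ {z | z ∈ Φ ∧ F x z = K}.encard ↔ ∃ m : ℕ, ∃ v : Fin k → ℂ,
      (∀ i, v i ∈ Φ) ∧ (∀ i j, i ≠ j → 1 / ((m : ℝ) + 1) ≤ dist (v i) (v j)) ∧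
        ∀ i, F x (v i) = K := by
  constructor
  · intro h
    obtain ⟨t, ht, hk⟩ := Set.exists_subset_encard_eq h
    have hfin : t.Finite := Set.finite_of_encard_eq_coe hk
    have : Fintype t := hfin.fintype
    have hcard : Fintype.card t = k := by
      rw [← Set.toFinset_card, ← Set.ncard_eq_toFinset_card', Set.ncard, hk]; rfl
    let e := (Fintype.equivFinOfCardEq hcard).symm
    have hpos : ∀ q : Fin k × Fin k, ∃ m : ℕ, q.1 ≠ q.2 →
        1 / ((m : ℝ) + 1) ≤ dist (e q.1 : ℂ) (e q.2) := fun q => by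
      by_cases hq : q.1 = q.2
      · exact ⟨0, fun h => absurd hq h⟩
      · obtain ⟨m, hm⟩ := exists_nat_one_div_lt (dist_pos.2 fun h' =>
          hq (e.injective (Subtype.ext h')) : 0 < dist (e q.1 : ℂ) (e q.2))
        exact ⟨m, fun _ => hm.le⟩
    choose m hm using hpos
    refine ⟨Finset.univ.sup m, fun i => e i, fun i => (ht (e i).2).1, fun i j hij => ?_,
      fun i => (ht (e i).2).2⟩
    refine le_trans ?_ (hm (i, j) hij)
    have : m (i, j) ≤ Finset.univ.sup m := Finset.le_sup (Finset.mem_univ _)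
    gcongr
  · rintro ⟨m, v, h1, h2, h3⟩
    have hinj : Function.Injective v := fun i j hij => by
      by_contra hne
      have := h2 i j hne
      rw [hij, dist_self] at this
      exact absurd this (not_le.2 (by positivity))
    calc (k : ℕ∞) = (Set.range v).encard := by
          rw [← Set.image_univ, hinj.encard_image]; simp
      _ ≤ _ := Set.encard_le_encard (by rintro _ ⟨i, rfl⟩; exact ⟨h1 i, h3 i⟩)

lemma measurable_levelCount {X : Type*} [TopologicalSpace X] [MeasurableSpace X] [BorelSpace X]
    {F : X → ℂ → ℂ} (hF : Continuous fun q : X × ℂ => F q.1 q.2) (K : ℂ) {Φ : Set ℂ}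
    (hΦ : IsCompact Φ) : Measurable fun x => levelCount (F x) K Φ := by
  have hnat : ∀ k : ℕ, MeasurableSet {x | (k : ℕ∞) ≤ {z | z ∈ Φ ∧ F x z = K}.encard} := by
    intro k
    simp only [natCast_le_encard_fiber_iff, Set.ofPred_exists]
    refine MeasurableSet.iUnion fun m => IsClosed.measurableSet ?_
    have : CompactSpace Φ := isCompact_iff_compactSpace.1 hΦ
    have hcl : IsClosed {q : (Fin k → Φ) × X |
        (∀ i j, i ≠ j → 1 / ((m : ℝ) + 1) ≤ dist (q.1 i : ℂ) (q.1 j))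
          ∧ ∀ i, F q.2 (q.1 i) = K} := by
      simp only [Set.ofPred_and, Set.ofPred_forall]
      refine .inter (isClosed_iInter fun i => isClosed_iInter fun j => isClosed_iInter fun _ =>
        isClosed_le continuous_const (by fun_prop)) (isClosed_iInter fun i => isClosed_eq ?_
          continuous_const)
      exact hF.comp (by fun_prop : Continuous fun q : (Fin k → Φ) × X => (q.2, (q.1 i : ℂ)))
    -- Projection along the compact factor `Φ ^ k` sends closed sets to closed sets.
    convert! isClosedMap_snd_of_compactSpace _ hcl using 1
    ext x
    simp only [Set.mem_iUnion, Set.mem_ofPred_eq, Set.mem_image, Prod.exists, exists_eq_right]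
    exact ⟨fun ⟨v, h1, h2⟩ => ⟨fun i => ⟨v i, h1 i⟩, h2⟩,
      fun ⟨v, h2⟩ => ⟨fun i => v i, fun i => (v i).2, h2⟩⟩
  have hm : Measurable fun x => {z | z ∈ Φ ∧ F x z = K}.encard := by
    refine measurable_to_countable' fun c => ?_
    induction c using ENat.recTopCoe with
    | coe k =>
      convert! (hnat k).diff (hnat (k + 1)) using 1
      ext x
      simp only [Set.mem_preimage, Set.mem_singleton_iff, Set.mem_sdiff, Set.mem_ofPred_eq]
      push_cast
      rw [ENat.add_one_le_iff (ENat.natCast_ne_top k), not_lt, eq_comm]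
      exact le_antisymm_iff
    | top =>
      convert! MeasurableSet.iInter hnat using 1
      ext x
      simp only [Set.mem_preimage, Set.mem_singleton_iff, Set.mem_iInter, Set.mem_ofPred_eq]
      exact ENat.eq_top_iff_forall_ge
  exact (measurable_of_countable ((↑) : ℕ∞ → ENNReal)).comp hm

/-! ### Three-term recurrence and Christoffel–Darboux identities. -/

namespace IsOrthonormalPolynomials

variable {μ : Measure ℝ} {p : ℕ → ℝ[X]}

lemma integrable_eval (hp : IsOrthonormalPolynomials μ p) (q : ℝ[X]) :
    Integrable (fun x => q.eval x) μ := by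
  simp_rw [eval_eq_sum_range]
  exact integrable_finsetSum _ fun i _ => (hp.integrable_pow i).const_mul _

lemma integrable_eval_mul (hp : IsOrthonormalPolynomials μ p) (q r : ℝ[X]) :
    Integrable (fun x => q.eval x * r.eval x) μ := by
  simpa using hp.integrable_eval (q * r)

lemma natDegree_eq (hp : IsOrthonormalPolynomials μ p) (n : ℕ) : (p n).natDegree = n :=
  natDegree_eq_of_degree_eq_some (hp.degree_eq n)

lemma leadingCoeff_ne_zero (hp : IsOrthonormalPolynomials μ p) (n : ℕ) :
    (p n).leadingCoeff ≠ 0 := by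
  rw [Ne, leadingCoeff_eq_zero, ← degree_eq_bot, hp.degree_eq]
  exact WithBot.coe_ne_bot

lemma exists_eq_sum (hp : IsOrthonormalPolynomials μ p) (n : ℕ) (q : ℝ[X]) (hq : q.degree < n) :
    ∃ c : ℕ → ℝ, q = ∑ j ∈ Finset.range n, C (c j) * p j := by
  induction n generalizing q with
  | zero => exact ⟨0, by simpa [Nat.WithBot.lt_zero_iff] using hq⟩
  | succ n ih =>
    obtain ⟨c, hc⟩ := ih (q - C (q.coeff n / (p n).leadingCoeff) * p n) (by
      rw [degree_lt_iff_coeff_zero] at hq ⊢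
      intro m hm
      rcases hm.eq_or_lt with rfl | hm
      · have : (p n).coeff n = (p n).leadingCoeff := by rw [leadingCoeff, hp.natDegree_eq]
        rw [coeff_sub, coeff_C_mul, this, div_mul_cancel₀ _ (hp.leadingCoeff_ne_zero n), sub_self]
      · rw [coeff_sub, coeff_C_mul, hq m hm,
          coeff_eq_zero_of_natDegree_lt (show (p n).natDegree < m by rwa [hp.natDegree_eq])]
        simp)
    refine ⟨fun j => if j = n then q.coeff n / (p n).leadingCoeff else c j, ?_⟩
    simp only [Finset.sum_range_succ, if_true]
    rw [← sub_eq_iff_eq_add, hc]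
    exact Finset.sum_congr rfl fun j hj => by rw [if_neg (Finset.mem_range.1 hj).ne]

lemma integral_sum_mul (hp : IsOrthonormalPolynomials μ p) (n : ℕ) (c : ℕ → ℝ) (k : ℕ) :
    ∫ x, (∑ j ∈ Finset.range n, C (c j) * p j).eval x * (p k).eval x ∂μ
      = if k < n then c k else 0 := by
  simp_rw [eval_finsetSum, eval_mul, eval_C, Finset.sum_mul, mul_assoc]
  rw [integral_finsetSum _ fun j _ => (hp.integrable_eval_mul _ _).const_mul _]
  simp_rw [integral_const_mul, hp.integral_mul]
  simp

lemma eq_sum_integral (hp : IsOrthonormalPolynomials μ p) {n : ℕ} {q : ℝ[X]} (hq : q.degree < n) :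
    q = ∑ j ∈ Finset.range n, C (∫ x, q.eval x * (p j).eval x ∂μ) * p j := by
  obtain ⟨c, rfl⟩ := hp.exists_eq_sum n q hq
  exact Finset.sum_congr rfl fun j hj => by
    rw [hp.integral_sum_mul, if_pos (Finset.mem_range.1 hj)]

lemma integral_eq_zero_of_degree_lt (hp : IsOrthonormalPolynomials μ p) {n : ℕ} {q : ℝ[X]}
    (hq : q.degree < n) : ∫ x, q.eval x * (p n).eval x ∂μ = 0 := by
  obtain ⟨c, rfl⟩ := hp.exists_eq_sum n q hq
  rw [hp.integral_sum_mul, if_neg (lt_irrefl n)]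

lemma degree_X_mul (hp : IsOrthonormalPolynomials μ p) (n : ℕ) :
    (X * p n).degree = ((n + 1 : ℕ) : WithBot ℕ) := by
  rw [degree_mul, degree_X, hp.degree_eq]
  push_cast
  exact add_comm _ _

/-- Subtracting `k_n / k_{n+1}` times `p (n + 1)` cancels the leading term, and what is left is
orthogonal to `p (n + 1)`. -/
lemma integral_X_mul_succ (hp : IsOrthonormalPolynomials μ p) (n : ℕ) :
    ∫ x, (X * p n).eval x * (p (n + 1)).eval x ∂μ = (coeffRatio p n)⁻¹ := by
  have hc : ∀ m, (p m).coeff m = (p m).leadingCoeff := fun m => by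
    rw [leadingCoeff, hp.natDegree_eq]
  have hdeg : (X * p n - C (coeffRatio p n)⁻¹ * p (n + 1)).degree < ((n + 1 : ℕ) : WithBot ℕ) := by
    rw [degree_lt_iff_coeff_zero]
    intro m hm
    rcases hm.eq_or_lt with rfl | hm
    · rw [coeff_sub, coeff_X_mul, coeff_C_mul, hc, hc, coeffRatio, inv_div,
        div_mul_cancel₀ _ (hp.leadingCoeff_ne_zero _), sub_self]
    · rw [coeff_sub, coeff_C_mul, coeff_eq_zero_of_degree_lt (by
        rw [hp.degree_X_mul]; exact_mod_cast hm),
        coeff_eq_zero_of_degree_lt (by rw [hp.degree_eq]; exact_mod_cast hm)]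
      simp
  have h := hp.integral_eq_zero_of_degree_lt hdeg
  simp_rw [eval_sub, sub_mul] at h
  rw [integral_sub (hp.integrable_eval_mul _ _) (hp.integrable_eval_mul _ _), sub_eq_zero] at h
  rw [h]
  simp_rw [eval_mul, eval_C, mul_assoc]
  rw [integral_const_mul, hp.integral_mul, if_pos rfl, mul_one]

lemma integral_X_mul_comm (j k : ℕ) :
    ∫ x, (X * p j).eval x * (p k).eval x ∂μ = ∫ x, (X * p k).eval x * (p j).eval x ∂μ := by
  congr 1
  funext x
  simp only [eval_mul, eval_X]
  ring

lemma exists_recurrence_zero (hp : IsOrthonormalPolynomials μ p) :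
    ∃ b : ℝ, X * p 0 = C (coeffRatio p 0)⁻¹ * p 1 + C b * p 0 := by
  have h := hp.eq_sum_integral (n := 2) (q := X * p 0) (by rw [hp.degree_X_mul]; norm_num)
  have h1 := hp.integral_X_mul_succ 0
  rw [zero_add] at h1
  rw [Finset.sum_range_succ, Finset.sum_range_one, h1, add_comm] at h
  exact ⟨_, h⟩

/-- Multiplication by `X` is symmetric for the inner product: coefficients below index `n` vanish,
and the one at `n` is the top coefficient of `X * p n`. -/
lemma exists_recurrence (hp : IsOrthonormalPolynomials μ p) (n : ℕ) :
    ∃ b : ℝ, X * p (n + 1) = C (coeffRatio p (n + 1))⁻¹ * p (n + 2) + C b * p (n + 1)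
      + C (coeffRatio p n)⁻¹ * p n := by
  have h := hp.eq_sum_integral (n := n + 3) (q := X * p (n + 1))
    (by rw [hp.degree_X_mul]; norm_cast; omega)
  rw [Finset.sum_range_succ, Finset.sum_range_succ, Finset.sum_range_succ,
    hp.integral_X_mul_succ, integral_X_mul_comm (n + 1) n, hp.integral_X_mul_succ,
    Finset.sum_eq_zero fun j hj => ?_] at h
  · exact ⟨∫ x, (X * p (n + 1)).eval x * (p (n + 1)).eval x ∂μ, h.trans (by ring)⟩
  · rw [integral_X_mul_comm, hp.integral_eq_zero_of_degree_lt, C_0, zero_mul]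
    rw [hp.degree_X_mul]
    exact_mod_cast Nat.succ_lt_succ (Finset.mem_range.1 hj)

/-- The Christoffel–Darboux formula. -/
lemma christoffel_darboux (hp : IsOrthonormalPolynomials μ p) (N : ℕ) (x y : ℂ) :
    (x - y) * ∑ j ∈ Finset.range (N + 1), valC (p j) x * valC (p j) y
      = (((coeffRatio p N)⁻¹ : ℝ) : ℂ)
        * (valC (p (N + 1)) x * valC (p N) y - valC (p N) x * valC (p (N + 1)) y) := by
  have key : ∀ {q r s : ℝ[X]} {a b : ℝ}, X * q = C a * r + C b * q + s → ∀ z : ℂ,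
      z * valC q z = a * valC r z + b * valC q z + valC s z := fun h z => by
    simpa [valC] using congrArg (fun t => aeval z t) h
  induction N with
  | zero =>
    obtain ⟨b, hb⟩ := hp.exists_recurrence_zero
    -- The recurrence at index zero has no lower term; `0` takes the place of `s` in `key`.
    rw [← add_zero (_ + _)] at hb
    have hx := key hb x
    have hy := key hb y
    simp only [valC, map_zero, add_zero] at hx hy ⊢
    rw [Finset.sum_range_one]
    linear_combination aeval y (p 0) * hx - aeval x (p 0) * hy
  | succ n ih =>
    obtain ⟨b, hb⟩ := hp.exists_recurrence n
    have hx := key hb x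
    have hy := key hb y
    simp only [valC, map_mul, aeval_C, Complex.coe_algebraMap] at hx hy ih ⊢
    rw [Finset.sum_range_succ, mul_add, ih]
    -- Antisymmetrizing in `x` and `y` kills the `b` term, and the lower terms cancel the induction
    -- hypothesis.
    linear_combination aeval y (p (n + 1)) * hx - aeval x (p (n + 1)) * hy

/-- The derivative in `x` of the Christoffel–Darboux formula. Keeping `x` and `y` independent lets
each differentiation be holomorphic; `y = z̄` is substituted only afterwards. -/
lemma christoffel_darboux_deriv (hp : IsOrthonormalPolynomials μ p) (N : ℕ) (x y : ℂ) :
    ∑ j ∈ Finset.range (N + 1), valC (p j) x * valC (p j) y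
        + (x - y) * ∑ j ∈ Finset.range (N + 1), valC (derivative (p j)) x * valC (p j) y
      = (((coeffRatio p N)⁻¹ : ℝ) : ℂ) * (valC (derivative (p (N + 1))) x * valC (p N) y
          - valC (derivative (p N)) x * valC (p (N + 1)) y) := by
  have hd : ∀ q : ℝ[X], HasDerivAt (fun z : ℂ => valC q z) (valC (derivative q) x) x :=
    fun q => q.hasDerivAt_aeval x
  have h1 := ((hasDerivAt_id x).sub_const y).mul (HasDerivAt.fun_sum
    (u := Finset.range (N + 1)) fun j _ => (hd (p j)).mul_const (valC (p j) y))
  have h2 := (((hd (p (N + 1))).mul_const (valC (p N) y)).sub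
    ((hd (p N)).mul_const (valC (p (N + 1)) y))).const_mul (((coeffRatio p N)⁻¹ : ℝ) : ℂ)
  have h3 := h1.unique (h2.congr_of_eventuallyEq
    (.of_forall fun z => hp.christoffel_darboux N z y))
  simpa using h3

lemma christoffel_darboux_deriv_deriv (hp : IsOrthonormalPolynomials μ p) (N : ℕ) (x y : ℂ) :
    ∑ j ∈ Finset.range (N + 1), valC (p j) x * valC (derivative (p j)) y
        - ∑ j ∈ Finset.range (N + 1), valC (derivative (p j)) x * valC (p j) y
        + (x - y) * ∑ j ∈ Finset.range (N + 1),
            valC (derivative (p j)) x * valC (derivative (p j)) y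
      = (((coeffRatio p N)⁻¹ : ℝ) : ℂ)
        * (valC (derivative (p (N + 1))) x * valC (derivative (p N)) y
          - valC (derivative (p N)) x * valC (derivative (p (N + 1))) y) := by
  have hd : ∀ q : ℝ[X], HasDerivAt (fun z : ℂ => valC q z) (valC (derivative q) y) y :=
    fun q => q.hasDerivAt_aeval y
  have h1 := (HasDerivAt.fun_sum (u := Finset.range (N + 1))
    fun j _ => (hd (p j)).const_mul (valC (p j) x)).add
    (((hasDerivAt_id y).const_sub x).mul (HasDerivAt.fun_sum (u := Finset.range (N + 1))
      fun j _ => (hd (p j)).const_mul (valC (derivative (p j)) x)))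
  have h2 := (((hd (p N)).const_mul (valC (derivative (p (N + 1))) x)).sub
    ((hd (p (N + 1))).const_mul (valC (derivative (p N)) x))).const_mul
      (((coeffRatio p N)⁻¹ : ℝ) : ℂ)
  have h3 := h1.unique (h2.congr_of_eventuallyEq
    (.of_forall fun z => hp.christoffel_darboux_deriv N x z))
  rw [← h3]
  simp only [id_eq]
  ring

end IsOrthonormalPolynomials

/-! ### Kernel sums at `(z, z̄)` and the closed formula. -/

lemma valC_conj (q : ℝ[X]) (z : ℂ) :
    valC q ((starRingEnd ℂ) z) = (starRingEnd ℂ) (valC q z) := by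
  simp only [valC]
  exact aeval_conj q z

/-- The diagonal `∑_{j ≤ N} |p_j(z)|²` of the kernel. -/
noncomputable def kernelDiag (p : ℕ → ℝ[X]) (N : ℕ) (z : ℂ) : ℝ :=
  ∑ j ∈ Finset.range (N + 1), ‖valC (p j) z‖ ^ 2

/-- `∑_{j ≤ N} p_j'(z) conj p_j(z)`. -/
noncomputable def kernelMixed (p : ℕ → ℝ[X]) (N : ℕ) (z : ℂ) : ℂ :=
  ∑ j ∈ Finset.range (N + 1), valC (derivative (p j)) z * (starRingEnd ℂ) (valC (p j) z)

/-- `∑_{j ≤ N} |p_j'(z)|²`. -/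
noncomputable def kernelDerivDiag (p : ℕ → ℝ[X]) (N : ℕ) (z : ℂ) : ℝ :=
  ∑ j ∈ Finset.range (N + 1), ‖valC (derivative (p j)) z‖ ^ 2

namespace IsOrthonormalPolynomials

variable {μ : Measure ℝ} {p : ℕ → ℝ[X]}

lemma coeffRatio_ne_zero (hp : IsOrthonormalPolynomials μ p) (N : ℕ) : coeffRatio p N ≠ 0 :=
  div_ne_zero (hp.leadingCoeff_ne_zero _) (hp.leadingCoeff_ne_zero _)

lemma exists_valC_zero (hp : IsOrthonormalPolynomials μ p) :
    ∃ c : ℂ, c ≠ 0 ∧ ∀ z, valC (p 0) z = c := by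
  have h := eq_C_of_degree_eq_zero (hp.degree_eq 0)
  refine ⟨((p 0).coeff 0 : ℝ), ?_, fun z => by rw [valC, h]; simp⟩
  have := hp.leadingCoeff_ne_zero 0
  rw [leadingCoeff, hp.natDegree_eq] at this
  exact_mod_cast this

lemma kernelDiag_pos (hp : IsOrthonormalPolynomials μ p) (N : ℕ) (z : ℂ) :
    0 < kernelDiag p N z := by
  obtain ⟨c, hc, h⟩ := hp.exists_valC_zero
  refine Finset.sum_pos' (fun j _ => by positivity) ⟨0, by simp, ?_⟩
  rw [h]
  positivity

/-- Christoffel–Darboux at `(z, z̄)`, where `x - y = 2 i Im z`. Positivity of the sum then makes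
`cdIm` nonzero off the real axis. -/
lemma im_mul_kernelDiag (hp : IsOrthonormalPolynomials μ p) (N : ℕ) (z : ℂ) :
    z.im * kernelDiag p N z = (coeffRatio p N)⁻¹ * cdIm p N z := by
  have h := congrArg Complex.im (hp.christoffel_darboux N z ((starRingEnd ℂ) z))
  simp only [valC_conj, Complex.mul_conj, Complex.normSq_eq_norm_sq] at h
  rw [← Complex.ofReal_sum, Complex.im_mul_ofReal, Complex.im_ofReal_mul] at h
  simp only [Complex.sub_im, Complex.conj_im, Complex.mul_im, Complex.conj_re] at h
  simp only [kernelDiag, cdIm, Complex.mul_im, Complex.conj_re, Complex.conj_im]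
  linear_combination h / 2

lemma kernelDiag_add_mul_kernelMixed (hp : IsOrthonormalPolynomials μ p) (N : ℕ) (z : ℂ) :
    (kernelDiag p N z : ℂ) + 2 * z.im * Complex.I * kernelMixed p N z
      = ((coeffRatio p N)⁻¹ : ℝ) * cdMixed p N z := by
  have h := hp.christoffel_darboux_deriv N z ((starRingEnd ℂ) z)
  simp only [valC_conj, Complex.sub_conj] at h
  simp only [Complex.mul_conj, Complex.normSq_eq_norm_sq] at h
  rw [← Complex.ofReal_sum, ← kernelDiag, ← kernelMixed] at h
  push_cast at h
  rw [h, cdMixed]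
  push_cast
  ring

lemma im_mul_kernelDerivDiag (hp : IsOrthonormalPolynomials μ p) (N : ℕ) (z : ℂ) :
    z.im * kernelDerivDiag p N z - (kernelMixed p N z).im
      = (coeffRatio p N)⁻¹ * cdDerivIm p N z := by
  have h := congrArg Complex.im (hp.christoffel_darboux_deriv_deriv N z ((starRingEnd ℂ) z))
  have hc : ∑ j ∈ Finset.range (N + 1), valC (p j) z * (starRingEnd ℂ) (valC (derivative (p j)) z)
      = (starRingEnd ℂ) (kernelMixed p N z) := by
    rw [kernelMixed, map_sum]
    exact Finset.sum_congr rfl fun j _ => by rw [map_mul, Complex.conj_conj, mul_comm]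
  simp only [valC_conj] at h
  rw [hc, ← kernelMixed] at h
  simp only [Complex.mul_conj, Complex.normSq_eq_norm_sq] at h
  rw [← Complex.ofReal_sum, ← kernelDerivDiag, Complex.im_ofReal_mul, Complex.add_im,
    Complex.im_mul_ofReal] at h
  simp only [Complex.sub_im, Complex.conj_im, Complex.mul_im, Complex.conj_re] at h
  simp only [cdDerivIm, Complex.mul_im, Complex.conj_re, Complex.conj_im]
  linear_combination h / 2

lemma cdIm_ne_zero (hp : IsOrthonormalPolynomials μ p) (N : ℕ) {z : ℂ} (hz : z.im ≠ 0) :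
    cdIm p N z ≠ 0 := fun h => by
  have h1 := hp.im_mul_kernelDiag N z
  rw [h, mul_zero] at h1
  exact mul_ne_zero hz (hp.kernelDiag_pos N z).ne' h1

lemma gaussianLevelDensity_kernel (hp : IsOrthonormalPolynomials μ p) (N : ℕ) {z : ℂ}
    (hz : z.im ≠ 0) (K₁ K₂ : ℝ) :
    gaussianLevelDensity (kernelDiag p N z) (kernelMixed p N z) (kernelDerivDiag p N z) 0
        ((K₁ : ℂ) + (K₂ : ℂ) * Complex.I)
      = 1 / Real.pi
          * Real.exp (-((K₁ ^ 2 + K₂ ^ 2) * coeffRatio p N * z.im / (2 * cdIm p N z)))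
          * (cdDerivIm p N z / cdIm p N z
              - ‖cdMixed p N z‖ ^ 2 / (4 * cdIm p N z ^ 2)
              + 1 / (4 * z.im ^ 2)
              + (K₁ ^ 2 + K₂ ^ 2) * coeffRatio p N
                * (‖cdMixed p N z‖ ^ 2 * z.im / (8 * cdIm p N z ^ 3)
                    - (cdMixed p N z).re / (4 * cdIm p N z ^ 2)
                    + 1 / (8 * z.im * cdIm p N z))) := by
  have hr := hp.coeffRatio_ne_zero N
  have hA := (hp.kernelDiag_pos N z).ne'
  have hrC : ((coeffRatio p N : ℝ) : ℂ) ≠ 0 := by exact_mod_cast hr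
  have hπ := Real.pi_ne_zero
  have e0 := hp.im_mul_kernelDiag N z
  have e1 := hp.kernelDiag_add_mul_kernelMixed N z
  have e2 := hp.im_mul_kernelDerivDiag N z
  unfold gaussianLevelDensity
  generalize coeffRatio p N = r at *
  generalize cdIm p N z = I at *
  generalize cdDerivIm p N z = J at *
  generalize cdMixed p N z = D at *
  generalize kernelDiag p N z = A at *
  generalize kernelMixed p N z = B at *
  generalize kernelDerivDiag p N z = E at *
  generalize z.im = y at *
  -- Eliminating `I`, `J`, `D` in favour of the kernel sums `A`, `B`, `E` leaves an identity of
  -- rational functions with denominators in `r`, `y`, `A`.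
  obtain rfl : I = r * (y * A) := by rw [e0]; field_simp
  obtain rfl : J = r * (y * E - B.im) := by rw [e2]; field_simp
  obtain rfl : D = r * (A + 2 * y * Complex.I * B) := by
    rw [e1]; push_cast; field_simp
  have hK : ‖(K₁ : ℂ) + (K₂ : ℂ) * Complex.I‖ ^ 2 = K₁ ^ 2 + K₂ ^ 2 := by
    rw [← Complex.normSq_eq_norm_sq, Complex.normSq_add_mul_I]
  have hBK : ‖0 + B * ((K₁ : ℂ) + (K₂ : ℂ) * Complex.I) / A‖ ^ 2
      = ‖B‖ ^ 2 * (K₁ ^ 2 + K₂ ^ 2) / A ^ 2 := by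
    rw [zero_add, norm_div, norm_mul, div_pow, mul_pow, hK, Complex.norm_real, Real.norm_eq_abs,
      sq_abs]
  have hre : ((r : ℂ) * (A + 2 * y * Complex.I * B)).re = r * (A - 2 * y * B.im) := by
    simp [sub_eq_add_neg]
  have hnD : ‖(r : ℂ) * (A + 2 * y * Complex.I * B)‖ ^ 2
      = r ^ 2 * (A ^ 2 - 4 * A * y * B.im + 4 * y ^ 2 * ‖B‖ ^ 2) := by
    rw [← Complex.normSq_eq_norm_sq, ← Complex.normSq_eq_norm_sq, Complex.normSq_apply,
      Complex.normSq_apply]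
    simp
    ring
  have hexp : (K₁ ^ 2 + K₂ ^ 2) * r * y / (2 * (r * (y * A))) = (K₁ ^ 2 + K₂ ^ 2) / (2 * A) := by
    field_simp
  rw [hBK, hK, hre, hnD, hexp]
  field_simp
  ring

end IsOrthonormalPolynomials

/-! ### The expected count as an integral over `Φ`. -/

/-- Independence gives a product of `2N + 2` real Gaussians; regrouping the coordinates in pairs
`(a_j, b_j)` makes it a product of planar ones. -/
lemma IsIIDStandardGaussian.map_eq_pi {Ω : Type*} [MeasurableSpace Ω] {P : Measure Ω}
    [IsProbabilityMeasure P] {N : ℕ} {a b : Fin (N + 1) → Ω → ℝ}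
    (hab : IsIIDStandardGaussian P N a b) :
    P.map (fun ω (j : Fin (N + 1)) => (a j ω : ℂ) + (b j ω : ℂ) * Complex.I)
      = Measure.pi fun _ => complexGaussian := by
  have hm : ∀ i, Measurable (Sum.elim a b i) := by
    rintro (i | i)
    exacts [hab.measurable_left i, hab.measurable_right i]
  have h1 := (iIndepFun_iff_map_fun_eq_pi_map fun i => (hm i).aemeasurable).1 hab.indep
  have hlaw : (fun i => P.map (Sum.elim a b i)) = fun _ => gaussianReal 0 1 := by
    funext i
    rcases i with i | i
    exacts [hab.law_left i, hab.law_right i]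
  rw [hlaw] at h1
  have m1 := measurePreserving_sumPiEquivProdPi
    (fun _ : Fin (N + 1) ⊕ Fin (N + 1) => gaussianReal 0 1)
  have m2 := (measurePreserving_arrowProdEquivProdArrow ℝ ℝ (Fin (N + 1))
    (fun _ => gaussianReal 0 1) (fun _ => gaussianReal 0 1)).symm
  have hφ : Measurable fun x : ℝ × ℝ => (x.1 : ℂ) + (x.2 : ℂ) * Complex.I := by fun_prop
  have : ∀ _ : Fin (N + 1), SigmaFinite (((gaussianReal 0 1).prod (gaussianReal 0 1)).map
      fun x : ℝ × ℝ => (x.1 : ℂ) + (x.2 : ℂ) * Complex.I) := fun _ => by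
    rw [map_gaussianReal_prod_eq_complexGaussian]; infer_instance
  have h3 := Measure.pi_map_pi (μ := fun _ : Fin (N + 1) =>
    (gaussianReal 0 1).prod (gaussianReal 0 1)) (f := fun _ x => (x.1 : ℂ) + (x.2 : ℂ) * Complex.I)
    fun _ => hφ.aemeasurable
  simp only [map_gaussianReal_prod_eq_complexGaussian] at h3
  rw [← h3, ← m2.map_eq, ← m1.map_eq, ← h1, Measure.map_map m1.measurable
    (measurable_pi_lambda _ hm), Measure.map_map m2.measurable
    (m1.measurable.comp (measurable_pi_lambda _ hm)), Measure.map_map (by fun_prop)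
    (m2.measurable.comp (m1.measurable.comp (measurable_pi_lambda _ hm)))]
  rfl

lemma continuous_valC (q : ℝ[X]) : Continuous (valC q) := q.continuous_aeval

lemma hasDerivAt_valC (q : ℝ[X]) (z : ℂ) : HasDerivAt (valC q) (valC (derivative q) z) z :=
  q.hasDerivAt_aeval z

/-- Solutions of `ξ c + G(z) = K` are the points where `(K - G) / c` takes the value `ξ`, so the
area formula applies. The parameters `(|c|², 0, 0)` describe the pair `X = c ξ`, `Y = 0`. -/
lemma lintegral_levelCount_const_mul_add {G : ℂ → ℂ} (hG : Differentiable ℂ G) {c : ℂ}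
    (hc : c ≠ 0) (K : ℂ) {Φ : Set ℂ} (hΦ : IsCompact Φ) :
    ∫⁻ ξ, levelCount (fun z => ξ * c + G z) K Φ ∂complexGaussian
      = ∫⁻ z in Φ, ENNReal.ofReal (gaussianLevelDensity (‖c‖ ^ 2) 0 0 (deriv G z) (K - G z)) := by
  have hGc := hG.continuous
  have hπ := Real.pi_pos
  have hlev : ∀ ξ, levelCount (fun z => ξ * c + G z) K Φ
      = levelCount (fun z => (K - G z) / c) ξ Φ := fun ξ => by
    unfold levelCount
    congr 3
    ext z
    refine and_congr_right fun _ => ?_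
    rw [div_eq_iff hc, sub_eq_iff_eq_add, eq_comm]
  rw [complexGaussian, lintegral_withDensity_eq_lintegral_mul _ (by fun_prop)
    (measurable_levelCount (F := fun ξ z => ξ * c + G z) (by fun_prop) K hΦ)]
  simp only [Pi.mul_apply, hlev]
  rw [lintegral_mul_levelCount ((hG.const_sub K).div_const c) hΦ.measurableSet (by fun_prop)]
  refine lintegral_congr fun z => ?_
  rw [← ENNReal.ofReal_mul (by positivity)]
  congr 1
  have hd : deriv (fun z => (K - G z) / c) z = -deriv G z / c := by
    rw [deriv_div_const, deriv_const_sub]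
  have hc' : ‖c‖ ≠ 0 := norm_ne_zero_iff.2 hc
  have he : (‖K - G z‖ / ‖c‖) ^ 2 / 2 = ‖K - G z‖ ^ 2 / (2 * ‖c‖ ^ 2) := by field_simp
  rw [hd, gaussianLevelDensity, norm_div, norm_div, norm_neg, he]
  simp only [zero_mul, zero_div, add_zero, norm_zero]
  field_simp
  ring

/-- The density of the expected number of solutions of `∑_{j ≤ N} η_j p_j(z) = K`. -/
noncomputable def levelDensity (p : ℕ → ℝ[X]) (N : ℕ) (K z : ℂ) : ℝ :=
  gaussianLevelDensity (kernelDiag p N z) (kernelMixed p N z) (kernelDerivDiag p N z) 0 K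

namespace IsOrthonormalPolynomials

variable {μ : Measure ℝ} {p : ℕ → ℝ[X]}

lemma continuous_levelDensity (hp : IsOrthonormalPolynomials μ p) (N : ℕ) (K : ℂ) :
    Continuous (levelDensity p N K) := by
  have hv : ∀ q : ℝ[X], Continuous (valC q) := continuous_valC
  have h0 : Continuous (kernelDiag p N) := by unfold kernelDiag; fun_prop
  have h1 : Continuous (kernelMixed p N) := by unfold kernelMixed; fun_prop
  have h2 : Continuous (kernelDerivDiag p N) := by unfold kernelDerivDiag; fun_prop
  have hne : ∀ z, kernelDiag p N z ≠ 0 := fun z => (hp.kernelDiag_pos N z).ne'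
  have hneC : ∀ z, (kernelDiag p N z : ℂ) ≠ 0 := fun z => by exact_mod_cast hne z
  have hne2 : ∀ z, 2 * kernelDiag p N z ≠ 0 := fun z => mul_ne_zero two_ne_zero (hne z)
  have hne3 : ∀ z, 2 * Real.pi * kernelDiag p N z ≠ 0 := fun z =>
    mul_ne_zero (by positivity) (hne z)
  unfold levelDensity gaussianLevelDensity
  fun_prop (disch := assumption)

/-- Cauchy–Schwarz, one index at a time; it makes the density nonnegative. -/
lemma kernelMixed_sq_le (hp : IsOrthonormalPolynomials μ p) (N : ℕ) (z : ℂ) :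
    ‖kernelMixed p N z‖ ^ 2 ≤ kernelDerivDiag p N z * kernelDiag p N z := by
  induction N with
  | zero => simp [kernelMixed, kernelDerivDiag, kernelDiag, mul_pow]
  | succ N ih =>
    have h := norm_sq_add_mul_conj_le (hp.kernelDiag_pos N z) ih
      (valC (derivative (p (N + 1))) z) (valC (p (N + 1)) z)
    unfold kernelMixed kernelDerivDiag kernelDiag at h ⊢
    simpa only [Finset.sum_range_succ _ (N + 1)] using h

lemma levelDensity_nonneg (hp : IsOrthonormalPolynomials μ p) (N : ℕ) (K z : ℂ) :
    0 ≤ levelDensity p N K z :=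
  gaussianLevelDensity_nonneg (hp.kernelDiag_pos N z) (hp.kernelMixed_sq_le N z) 0 K

lemma lintegral_pi_levelCount (hp : IsOrthonormalPolynomials μ p) (N : ℕ) (K : ℂ) {Φ : Set ℂ}
    (hΦ : IsCompact Φ) :
    ∫⁻ η : Fin (N + 1) → ℂ, levelCount (fun z => ∑ j, η j * valC (p j) z) K Φ
        ∂(Measure.pi fun _ => complexGaussian)
      = ∫⁻ z in Φ, ENNReal.ofReal (levelDensity p N K z) := by
  obtain ⟨c, hc, hpc⟩ := hp.exists_valC_zero
  have hv : ∀ q : ℝ[X], Continuous (valC q) := continuous_valC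
  have hmp := (measurePreserving_piFinSuccAbove (fun _ : Fin (N + 1) => complexGaussian) 0).symm
  rw [← hmp.lintegral_comp_emb (MeasurableEquiv.measurableEmbedding _)]
  simp only [MeasurableEquiv.piFinSuccAbove_symm_apply, Fin.insertNthEquiv_apply,
    Fin.insertNth_zero', Fin.sum_univ_succ, Fin.cons_zero, Fin.cons_succ, Fin.val_zero,
    Fin.val_succ, hpc]
  rw [lintegral_prod_symm _ (measurable_levelCount
    (F := fun (x : ℂ × (Fin N → ℂ)) z => x.1 * c + ∑ j : Fin N, x.2 j * valC (p (j + 1)) z)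
    (by fun_prop) K hΦ).aemeasurable]
  simp only []
  have hder : ∀ (η : Fin N → ℂ) z, HasDerivAt (fun z => ∑ j : Fin N, η j * valC (p (j + 1)) z)
      (∑ j : Fin N, η j * valC (derivative (p (j + 1))) z) z := fun η z =>
    HasDerivAt.fun_sum fun j _ => (hasDerivAt_valC _ z).const_mul _
  have hstep : ∀ η : Fin N → ℂ, ∫⁻ ξ, levelCount
        (fun z => ξ * c + ∑ j : Fin N, η j * valC (p (j + 1)) z) K Φ ∂complexGaussian
      = ∫⁻ z in Φ, ENNReal.ofReal (gaussianLevelDensity (‖c‖ ^ 2) 0 0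
          (0 + ∑ j : Fin N, valC (derivative (p (j + 1))) z * η j)
          (K - ∑ j : Fin N, valC (p (j + 1)) z * η j)) := fun η => by
    rw [lintegral_levelCount_const_mul_add (fun z => (hder η z).differentiableAt) hc K hΦ]
    refine lintegral_congr fun z => ?_
    rw [(hder η z).deriv, zero_add]
    simp only [mul_comm]
  have hcont : Continuous fun x : (Fin N → ℂ) × ℂ => gaussianLevelDensity (‖c‖ ^ 2) 0 0
      (0 + ∑ j : Fin N, valC (derivative (p (j + 1))) x.2 * x.1 j)
      (K - ∑ j : Fin N, valC (p (j + 1)) x.2 * x.1 j) :=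
    (continuous_gaussianLevelDensity (‖c‖ ^ 2) 0 0).comp (by fun_prop :
      Continuous fun x : (Fin N → ℂ) × ℂ =>
        (0 + ∑ j : Fin N, valC (derivative (p (j + 1))) x.2 * x.1 j,
          K - ∑ j : Fin N, valC (p (j + 1)) x.2 * x.1 j))
  refine (lintegral_congr hstep).trans ?_
  rw [lintegral_lintegral_swap hcont.measurable.ennreal_ofReal.aemeasurable]
  refine lintegral_congr fun z => ?_
  rw [lintegral_pi_gaussianLevelDensity _ _ (by positivity) (by simp)]
  -- Index `0` contributes `|c|²` to the first kernel sum and nothing to the other two, in agreement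
  -- with the starting parameters.
  have hd0 : valC (derivative (p 0)) z = 0 := by
    rw [derivative_of_natDegree_zero (hp.natDegree_eq 0), valC, map_zero]
  simp only [levelDensity, kernelDiag, kernelMixed, kernelDerivDiag, Finset.sum_range,
    Fin.sum_univ_succ, Fin.val_zero, Fin.val_succ, hpc, hd0, zero_mul, norm_zero]
  norm_num

end IsOrthonormalPolynomials

/-! ### Existence and uniqueness of the density. -/

lemma isExpectedZeroDensity_of_lintegral_eq {Ω : Type*} [MeasurableSpace Ω] {P : Measure Ω}
    {S : Ω → ℂ → ℂ} {K : ℂ} {h : ℂ → ℝ} (hc : Continuous h) (h0 : ∀ z, 0 ≤ h z)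
    (hS : ∀ Φ, IsCompact Φ → AEMeasurable (fun ω => levelCount (S ω) K Φ) P ∧
      ∫⁻ ω, levelCount (S ω) K Φ ∂P = ∫⁻ z in Φ, ENNReal.ofReal (h z)) :
    IsExpectedZeroDensity P S K h := fun Φ hΦ => by
  have hi : IntegrableOn h Φ volume := hc.continuousOn.integrableOn_compact hΦ
  rw [(hS Φ hΦ).2, ← ofReal_integral_eq_lintegral_ofReal hi (.of_forall h0)]
  exact ⟨(hS Φ hΦ).1, hi, ENNReal.ofReal_ne_top,
    ENNReal.toReal_ofReal (integral_nonneg h0)⟩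

lemma IsExpectedZeroDensity.ae_eq {Ω : Type*} [MeasurableSpace Ω] {P : Measure Ω}
    {S : Ω → ℂ → ℂ} {K : ℂ} {g h : ℂ → ℝ} (hg : IsExpectedZeroDensity P S K g)
    (hh : IsExpectedZeroDensity P S K h) : g =ᵐ[volume] h := by
  have hz : (fun z => g z - h z) =ᵐ[volume] 0 := by
    refine ae_eq_zero_of_forall_setIntegral_isCompact_eq_zero' ?_ fun Φ hΦ => ?_
    · refine (locallyIntegrable_iff.2 fun Φ hΦ => ?_)
      exact (hg Φ hΦ).2.1.sub (hh Φ hΦ).2.1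
    · rw [integral_sub (hg Φ hΦ).2.1 (hh Φ hΦ).2.1, ← (hg Φ hΦ).2.2.2, ← (hh Φ hΦ).2.2.2, sub_self]
  filter_upwards [hz] with z hz
  exact sub_eq_zero.1 hz

theorem theorem9 {Ω : Type*} [MeasurableSpace Ω] (P : Measure Ω) [IsProbabilityMeasure P]
    (μ : Measure ℝ) (p : ℕ → ℝ[X]) (hp : IsOrthonormalPolynomials μ p)
    (N : ℕ) (hN : 0 < N) (a b : Fin (N + 1) → Ω → ℝ) (hab : IsIIDStandardGaussian P N a b)
    (K₁ K₂ : ℝ) :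
    ∃ h : ℂ → ℝ,
      Continuous h ∧
      IsExpectedZeroDensity P (randomSum a b (fun j => valC (p j)))
        ((K₁ : ℂ) + (K₂ : ℂ) * Complex.I) h ∧
      (∀ g : ℂ → ℝ,
        IsExpectedZeroDensity P (randomSum a b (fun j => valC (p j)))
          ((K₁ : ℂ) + (K₂ : ℂ) * Complex.I) g → g =ᵐ[volume] h) ∧
      (∀ z : ℂ, z.im ≠ 0 →
        cdIm p N z ≠ 0 ∧
        h z = 1 / Real.pi
          * Real.exp (-((K₁ ^ 2 + K₂ ^ 2) * coeffRatio p N * z.im / (2 * cdIm p N z)))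
          * (cdDerivIm p N z / cdIm p N z
              - ‖cdMixed p N z‖ ^ 2 / (4 * cdIm p N z ^ 2)
              + 1 / (4 * z.im ^ 2)
              + (K₁ ^ 2 + K₂ ^ 2) * coeffRatio p N
                * (‖cdMixed p N z‖ ^ 2 * z.im / (8 * cdIm p N z ^ 3)
                    - (cdMixed p N z).re / (4 * cdIm p N z ^ 2)
                    + 1 / (8 * z.im * cdIm p N z)))) ∧
      (K₁ = 0 → K₂ = 0 → ∀ z : ℂ, z.im ≠ 0 →
        h z = 1 / Real.pi
          * (cdDerivIm p N z / cdIm p N z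
              - ‖cdMixed p N z‖ ^ 2 / (4 * cdIm p N z ^ 2)
              + 1 / (4 * z.im ^ 2))) := by
  set K : ℂ := (K₁ : ℂ) + (K₂ : ℂ) * Complex.I with hK
  have hmeas : Measurable fun ω (j : Fin (N + 1)) => (a j ω : ℂ) + (b j ω : ℂ) * Complex.I :=
    measurable_pi_lambda _ fun j => (Complex.measurable_ofReal.comp (hab.measurable_left j)).add
      ((Complex.measurable_ofReal.comp (hab.measurable_right j)).mul_const _)
  have hv : ∀ q : ℝ[X], Continuous (valC q) := continuous_valC
  have hden : IsExpectedZeroDensity P (randomSum a b (fun j => valC (p j))) K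
      (levelDensity p N K) := by
    refine isExpectedZeroDensity_of_lintegral_eq (hp.continuous_levelDensity N K)
      (hp.levelDensity_nonneg N K) fun Φ hΦ => ?_
    have hm := measurable_levelCount (F := fun (η : Fin (N + 1) → ℂ) z =>
      ∑ j, η j * valC (p j) z) (by fun_prop) K hΦ
    refine ⟨(hm.comp hmeas).aemeasurable, ?_⟩
    rw [← hp.lintegral_pi_levelCount N K hΦ, ← hab.map_eq_pi, lintegral_map hm hmeas]
    rfl
  refine ⟨levelDensity p N K, hp.continuous_levelDensity N K, hden, fun g hg => hg.ae_eq hden,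
    fun z hz => ⟨hp.cdIm_ne_zero N hz, hp.gaussianLevelDensity_kernel N hz K₁ K₂⟩, ?_⟩
  -- At `K = 0` the exponential is `1` and the part of the bracket proportional to `K₁² + K₂²` drops
  -- out.
  rintro rfl rfl z hz
  rw [levelDensity, hK, hp.gaussianLevelDensity_kernel N hz]
  simp
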